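/- Let $G$ be a (discrete) group. Let $BG$ be the simplicial set whose $n$-simplices are the $n$-tuples $(g_1,\dots,g_n)\in G^n$ (the bar construction), let $EG$ be the simplicial set whose $n$-simplices are the $(n+1)$-tuples $(x_0,\dots,x_n)\in G^{n+1}$, and let $EG\to BG$, $(x_0,\dots,x_n)\mapsto(x_0^{-1}x_1,\dots,x_{n-1}^{-1}x_n)$, be the universal principal $G$-bundle. Let $B(2,G)\subseteq BG$ be the simplicial subset of those tuples $(g_1,\dots,g_n)$ that generate a subgroup of nilpotency class less than $2$, i.e. whose entries commute pairwise, and let $E(2,G)\to B(2,G)$ be the pullback of $EG\to BG$ along the inclusion $B(2,G)\subseteq BG$. Then $G$ is abelian if and only if (the geometric realization of) $E(2,G)$ is contractible. -/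

import Mathlib

open CategoryTheory

universe u

namespace ClassifyingSpace

theorem partialProd_inv_mul {G : Type u} [Group G] {n : ℕ} (y : Fin (n + 1) → G)
    (j : Fin (n + 1)) :
    Fin.partialProd (fun i : Fin n => (y i.castSucc)⁻¹ * y i.succ) j = (y 0)⁻¹ * y j := by
  induction j using Fin.induction with
  | zero => simp
  | succ i ih => rw [Fin.partialProd_succ, ih]; group

theorem partialProd_mem_closure {G : Type u} [Group G] {n : ℕ} (g : Fin n → G)
    (j : Fin (n + 1)) : Fin.partialProd g j ∈ Subgroup.closure (Set.range g) := by
  induction j using Fin.induction with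
  | zero => simp
  | succ i ih =>
    rw [Fin.partialProd_succ]
    exact mul_mem ih (Subgroup.subset_closure ⟨i, rfl⟩)

/-- The simplicial set `BG` of a discrete group `G` (the bar construction). Its `n`-simplices are
the `n`-tuples `(g₁, …, gₙ)`; a monotone map `f : [m] → [n]` sends such a tuple to the `m`-tuple
with entries `g_{f(i-1)+1} ⋯ g_{f(i)}`, written here as a quotient of partial products. So the
inner faces multiply adjacent entries, the outer faces drop the first or the last entry and the
degeneracies insert `1`. -/
def B (G : Type u) [Group G] : SSet.{u} where
  obj n := Fin n.unop.len → G
  map f := ↾fun g i =>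
    (Fin.partialProd g (f.unop.toOrderHom i.castSucc))⁻¹ *
      Fin.partialProd g (f.unop.toOrderHom i.succ)
  map_id n := by
    ext g i
    exact Fin.partialProd_right_inv g i
  map_comp f h := by
    ext g i
    change _ = (Fin.partialProd (fun j => (Fin.partialProd g (f.unop.toOrderHom j.castSucc))⁻¹ *
        Fin.partialProd g (f.unop.toOrderHom j.succ)) (h.unop.toOrderHom i.castSucc))⁻¹ *
      Fin.partialProd (fun j => (Fin.partialProd g (f.unop.toOrderHom j.castSucc))⁻¹ *
        Fin.partialProd g (f.unop.toOrderHom j.succ)) (h.unop.toOrderHom i.succ)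
    rw [partialProd_inv_mul (fun j => Fin.partialProd g (f.unop.toOrderHom j)),
      partialProd_inv_mul (fun j => Fin.partialProd g (f.unop.toOrderHom j)),
      mul_inv_rev, inv_inv, mul_assoc, mul_inv_cancel_left]
    rfl

/-- The simplicial set `EG`. Its `n`-simplices are the `(n+1)`-tuples `(x₀, …, xₙ)` of elements
of `G`; the group `G` acts freely on it by diagonal left multiplication. -/
def E (G : Type u) : SSet.{u} where
  obj n := Fin (n.unop.len + 1) → G
  map f := ↾fun x i => x (f.unop.toOrderHom i)

/-- The universal principal `G`-bundle `EG → BG`,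
`(x₀, …, xₙ) ↦ (x₀⁻¹ x₁, …, xₙ₋₁⁻¹ xₙ)`: it is onto and its fibres are the `G`-orbits. -/
def proj (G : Type u) [Group G] : E G ⟶ B G where
  app n := ↾fun x i => (x i.castSucc)⁻¹ * x i.succ
  naturality m n f := by
    ext x
    funext i
    change _ = (Fin.partialProd (fun j => (x j.castSucc)⁻¹ * x j.succ)
        (f.unop.toOrderHom i.castSucc))⁻¹ *
      Fin.partialProd (fun j => (x j.castSucc)⁻¹ * x j.succ) (f.unop.toOrderHom i.succ)
    rw [partialProd_inv_mul x, partialProd_inv_mul x, mul_inv_rev, inv_inv, mul_assoc,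
      mul_inv_cancel_left]
    rfl

/-- A subgroup that is nilpotent of class less than `q`. -/
def NilpotentOfClassLT (q : ℕ) {G : Type u} [Group G] (H : Subgroup G) : Prop :=
  Group.IsNilpotent H ∧ Group.nilpotencyClass H < q

theorem NilpotentOfClassLT.mono {q : ℕ} {G : Type u} [Group G] {H K : Subgroup G}
    (hK : NilpotentOfClassLT q K) (h : H ≤ K) : NilpotentOfClassLT q H := by
  obtain ⟨_, hq⟩ := hK
  have hs : Function.Surjective (Subgroup.subgroupOfEquivOfLe h).toMonoidHom :=
    (Subgroup.subgroupOfEquivOfLe h).surjective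
  exact ⟨Group.nilpotent_of_surjective _ hs,
    ((Group.nilpotencyClass_le_of_surjective _ hs).trans
      (Subgroup.nilpotencyClass_le (H.subgroupOf K))).trans_lt hq⟩

/-- The simplicial subset `B(q,G) ⊆ BG` of the tuples `(g₁, …, gₙ)` that generate a subgroup of
nilpotency class less than `q`. For `q = 2` these are the tuples of pairwise commuting elements. -/
def Bnil (q : ℕ) (G : Type u) [Group G] : (B G).Subcomplex where
  obj n := {g : Fin n.unop.len → G | NilpotentOfClassLT q (Subgroup.closure (Set.range g))}
  map f := by
    intro g hg
    refine NilpotentOfClassLT.mono hg ?_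
    rw [Subgroup.closure_le]
    rintro _ ⟨i, rfl⟩
    exact mul_mem (inv_mem (partialProd_mem_closure g _)) (partialProd_mem_closure g _)

/-- The total space `E(q,G)` of the pullback of the principal `G`-bundle `EG → BG` along the
inclusion `B(q,G) ⊆ BG`, as a simplicial subset of `EG`. -/
def Enil (q : ℕ) (G : Type u) [Group G] : (E G).Subcomplex :=
  (Bnil q G).preimage (proj G)

end ClassifyingSpace

/-!
If `G` is abelian, then `E(2,G)` is all of `EG`, and `EG` is contracted linearly onto one of its
vertices.

Conversely, let `x` be a simplex of `E(2,G)`. As the elements `xᵢ⁻¹ xⱼ` commute with each other,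
`⁅xᵢ, xⱼ⁆ * ⁅xⱼ, xₖ⁆ = ⁅xᵢ, xₖ⁆`: the commutator is a simplicial 1-cocycle with values in `G`, so it
glues the products of `G` with the open stars of the vertices to a covering space of the
realization. Over a simply connected realization this covering has a section, whose constant
values on the open stars are a function `u` on `G` with `u b = ⁅b, a⁆ * u a` for every edge
`(a, b)`. As every pair is an edge of `E(2,G)`, comparison with the vertex `1` shows that `u` is
constant, and hence that all commutators vanish.
-/

open Simplicial Opposite Topology
open scoped commutatorElement

noncomputable section

namespace ClassifyingSpace

section Realization

variable {X : SSet.{u}}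

/-- The characteristic map `Δⁿ → |X|` of an `n`-simplex of a simplicial set `X`. -/
def characteristicMap {n : SimplexCategory} (x : X.obj (op n)) :
    C(stdSimplex ℝ (Fin (n.len + 1)), |X|) :=
  TopCat.toSSetObjEquiv _ (op n) ((sSetTopAdj.homEquiv X |X| (𝟙 _)).app (op n) x)

theorem characteristicMap_map {m n : SimplexCategory} (f : m ⟶ n) (x : X.obj (op n))
    (t : stdSimplex ℝ (Fin (m.len + 1))) :
    characteristicMap (X.map f.op x) t = characteristicMap x (stdSimplex.map f t) := by
  rw [characteristicMap, NatTrans.naturality_apply]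
  rfl

variable {Y : Type u} [TopologicalSpace Y]

theorem hom_characteristicMap (F : |X| ⟶ TopCat.of Y) {n : SimplexCategory} (x : X.obj (op n))
    (t : stdSimplex ℝ (Fin (n.len + 1))) :
    F (characteristicMap x t) =
      TopCat.toSSetObjEquiv (TopCat.of Y) (op n)
        ((sSetTopAdj.homEquiv X (TopCat.of Y) F).app (op n) x) t := by
  rw [← Category.id_comp F, Adjunction.homEquiv_naturality_right, Category.id_comp]
  rfl

theorem realization_hom_ext {F F' : C(|X|, Y)}
    (h : ∀ (n : SimplexCategory) (x : X.obj (op n)) t,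
      F (characteristicMap x t) = F' (characteristicMap x t)) : F = F' := by
  suffices h_ofHom : TopCat.ofHom F = (TopCat.ofHom F' : |X| ⟶ TopCat.of Y) from
    congrArg TopCat.Hom.hom h_ofHom
  apply (sSetTopAdj.homEquiv X (TopCat.of Y)).injective
  ext n x
  apply (TopCat.toSSetObjEquiv (TopCat.of Y) n).injective
  ext t
  exact (hom_characteristicMap (TopCat.ofHom F) x t).symm.trans
    ((h n.unop x t).trans (hom_characteristicMap (TopCat.ofHom F') x t))

section Desc

variable (φ : ∀ n : SimplexCategory, X.obj (op n) → C(stdSimplex ℝ (Fin (n.len + 1)), Y))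
  (hφ : ∀ (m n : SimplexCategory) (f : m ⟶ n) (x : X.obj (op n)) t,
    φ m (X.map f.op x) t = φ n x (stdSimplex.map f t))

/-- The morphism from `X` to the singular simplicial set of `Y` that is given by a compatible
family of continuous maps on the simplices of `X`. -/
def singularHom : X ⟶ TopCat.toSSet.obj (TopCat.of Y) where
  app n := ↾fun x => (TopCat.toSSetObjEquiv (TopCat.of Y) n).symm (φ n.unop x)
  naturality n m f := by
    ext x
    apply (TopCat.toSSetObjEquiv (TopCat.of Y) m).injective
    ext t
    exact hφ m.unop n.unop f.unop x t

/-- The continuous map out of `|X|` that is obtained by glueing a compatible family of continuous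
maps on the simplices of `X`. -/
def realizationDesc : C(|X|, Y) :=
  ((sSetTopAdj.homEquiv X (TopCat.of Y)).symm (singularHom φ hφ)).hom

@[simp]
theorem realizationDesc_characteristicMap {n : SimplexCategory} (x : X.obj (op n))
    (t : stdSimplex ℝ (Fin (n.len + 1))) :
    realizationDesc φ hφ (characteristicMap x t) = φ n x t := by
  refine (hom_characteristicMap _ x t).trans ?_
  rw [Equiv.apply_symm_apply]
  rfl

end Desc

theorem exists_characteristicMap_eq (p : |X|) :
    ∃ (n : SimplexCategory) (x : X.obj (op n)) (t : stdSimplex ℝ (Fin (n.len + 1))),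
      characteristicMap x t = p := by
  -- The image and the whole space have the same indicator on every simplex.
  let _ : TopologicalSpace (ULift.{u} Prop) := ⊤
  have h_image : (⟨fun p => ⟨∃ (n : SimplexCategory) (x : X.obj (op n))
      (t : stdSimplex ℝ (Fin (n.len + 1))), characteristicMap x t = p⟩, continuous_top⟩ :
      C(|X|, ULift.{u} Prop)) = ⟨fun _ => ⟨True⟩, continuous_top⟩ :=
    realization_hom_ext fun n x t => ULift.ext _ _ (eq_true ⟨n, x, t, rfl⟩)
  exact of_eq_true (congrArg (fun F : C(|X|, ULift.{u} Prop) => (F p).down) h_image)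

theorem exists_isOpen_preimage_characteristicMap_eq
    (S : ∀ n : SimplexCategory, X.obj (op n) → Set (stdSimplex ℝ (Fin (n.len + 1))))
    (hS : ∀ n x, IsOpen (S n x))
    (hS_map : ∀ (m n : SimplexCategory) (f : m ⟶ n) (x : X.obj (op n)),
      S m (X.map f.op x) = stdSimplex.map f ⁻¹' S n x) :
    ∃ V : Set |X|, IsOpen V ∧
      ∀ (n : SimplexCategory) (x : X.obj (op n)), characteristicMap x ⁻¹' V = S n x := by
  -- Open subsets are continuous maps to the Sierpiński space.
  let indicator : C(|X|, ULift.{u} Prop) :=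
    realizationDesc
      (fun n x => ⟨fun t => ⟨t ∈ S n x⟩, continuous_uliftUp.comp (continuous_Prop.2 (hS n x))⟩)
      (fun m n f x t => ULift.ext _ _ (congrArg (t ∈ ·) (hS_map m n f x)))
  refine ⟨{p | (indicator p).down},
    continuous_Prop.1 (continuous_uliftDown.comp indicator.continuous), fun n x => ?_⟩
  ext t
  simp [indicator]

theorem isOpen_iff_isOpen_preimage_characteristicMap {V : Set |X|} :
    IsOpen V ↔ ∀ (n : SimplexCategory) (x : X.obj (op n)), IsOpen (characteristicMap x ⁻¹' V) := by
  refine ⟨fun hV n x => hV.preimage (characteristicMap x).continuous, fun hV => ?_⟩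
  obtain ⟨W, hW, hVW⟩ := exists_isOpen_preimage_characteristicMap_eq _ hV fun m n f x => by
    ext t
    simp only [Set.mem_preimage, characteristicMap_map]
  suffices h_eq : W = V from h_eq ▸ hW
  ext p
  obtain ⟨n, x, t, rfl⟩ := exists_characteristicMap_eq p
  exact Set.ext_iff.1 (hVW n x) t

instance (n : ℕ) : LocallyPathConnectedSpace (stdSimplex ℝ (Fin n)) :=
  (convex_stdSimplex ℝ (Fin n)).locallyPathConnectedSpace

theorem isQuotientMap_characteristicMap :
    IsQuotientMap fun p : Σ x : (Σ n : SimplexCategory, X.obj (op n)),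
      stdSimplex ℝ (Fin (x.1.len + 1)) => characteristicMap p.1.2 p.2 := by
  refine ⟨.of_isOpen_preimage_iff_isOpen fun V => ?_, fun p => ?_⟩
  · rw [isOpen_iff_isOpen_preimage_characteristicMap, isOpen_sigma_iff]
    exact ⟨fun h n x => h ⟨n, x⟩, fun h x => h x.1 x.2⟩
  · obtain ⟨n, x, t, h⟩ := exists_characteristicMap_eq p
    exact ⟨⟨⟨n, x⟩, t⟩, h⟩

instance : LocallyPathConnectedSpace |X| :=
  isQuotientMap_characteristicMap.locallyPathConnectedSpace

end Realization

section CechCocycle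

variable {ι B H : Type*} [Group H] {U : ι → Set B} {c : ι → ι → H}

/-- A Čech 1-cocycle, constant on each intersection, of a family of sets with values in a group. -/
def IsCechCocycle (U : ι → Set B) (c : ι → ι → H) : Prop :=
  ∀ i j k, (U i ∩ U j ∩ U k).Nonempty → c i j * c j k = c i k

variable [TopologicalSpace B]

/-- The principal bundle with discrete fibre `H` that is trivial over the members of the open
cover `U`, with the cocycle `c` as its transition functions: the fibre coordinate `h` over `U i`
becomes `c j i * h` over `U j`. -/
def IsCechCocycle.bundleCore [TopologicalSpace H] [DiscreteTopology H] (hc : IsCechCocycle U c)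
    (hU : ∀ i, IsOpen (U i)) (hU_cover : ∀ p, ∃ i, p ∈ U i) : FiberBundleCore ι B H where
  baseSet := U
  isOpen_baseSet := hU
  indexAt p := (hU_cover p).choose
  mem_baseSet_at p := (hU_cover p).choose_spec
  coordChange i j _ h := c j i * h
  coordChange_self i p hp h := by
    have h_one : c i i = 1 := mul_eq_left.1 (hc i i i ⟨p, ⟨hp, hp⟩, hp⟩)
    rw [h_one, one_mul]
  continuousOn_coordChange i j :=
    ((continuous_of_discreteTopology (f := (c j i * ·))).comp continuous_snd).continuousOn
  coordChange_comp i j k p hp h := by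
    rw [← mul_assoc, hc k j i ⟨p, ⟨hp.2, hp.1.2⟩, hp.1.1⟩]

theorem IsCechCocycle.localTriv_snd [TopologicalSpace H] [DiscreteTopology H]
    (hc : IsCechCocycle U c) (hU : ∀ i, IsOpen (U i)) (hU_cover : ∀ p, ∃ i, p ∈ U i) {i j : ι}
    {z : (hc.bundleCore hU hU_cover).TotalSpace} (hi : z.1 ∈ U i) (hj : z.1 ∈ U j) :
    ((hc.bundleCore hU hU_cover).localTriv j z).2 =
      c j i * ((hc.bundleCore hU hU_cover).localTriv i z).2 := by
  have hz := (hc.bundleCore hU hU_cover).mem_baseSet_at z.1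
  exact ((hc.bundleCore hU hU_cover).coordChange_comp _ i j z.1 ⟨⟨hz, hi⟩, hj⟩ z.2).symm

theorem exists_section_of_isCoveringMap {P : Type*} [TopologicalSpace P] [SimplyConnectedSpace B]
    [LocallyPathConnectedSpace B] {π : P → B} (hπ : IsCoveringMap π)
    (hπ_surj : Function.Surjective π) : ∃ s : C(B, P), ∀ p, π (s p) = p := by
  obtain ⟨p₀⟩ : Nonempty B := inferInstance
  obtain ⟨z₀, hz₀⟩ := hπ_surj p₀
  obtain ⟨s, ⟨-, hs⟩, -⟩ := hπ.existsUnique_continuousMap_lifts (.id B) p₀ z₀ hz₀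
  exact ⟨s, congrFun hs⟩

theorem IsCechCocycle.exists_coboundary [SimplyConnectedSpace B] [LocallyPathConnectedSpace B]
    (hc : IsCechCocycle U c) (hU : ∀ i, IsOpen (U i)) (hU_cover : ∀ p, ∃ i, p ∈ U i)
    (hU_conn : ∀ i, _root_.IsPreconnected (U i)) :
    ∃ u : ι → H, ∀ i j, (U i ∩ U j).Nonempty → u j = c j i * u i := by
  let _ : TopologicalSpace H := ⊥
  have _ : DiscreteTopology H := ⟨rfl⟩
  let Z := hc.bundleCore hU hU_cover
  have isCoveringMap_proj : IsCoveringMap (Bundle.TotalSpace.proj : Z.TotalSpace → B) :=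
    FiberBundle.isCoveringMap (F := H) (E := Z.Fiber)
  obtain ⟨s, hs⟩ := exists_section_of_isCoveringMap isCoveringMap_proj
    fun p => ⟨⟨p, (1 : H)⟩, rfl⟩
  let coord (i : ι) (p : B) : H := (Z.localTriv i (s p)).2
  have proj_mem {i : ι} {p : B} (hp : p ∈ U i) : (s p).1 ∈ U i := by rwa [hs p]
  have coord_constant (i : ι) {p q : B} (hp : p ∈ U i) (hq : q ∈ U i) : coord i p = coord i q :=
    (hU_conn i).constant (continuous_snd.comp_continuousOn ((Z.localTriv i).continuousOn.comp
      s.continuous.continuousOn fun _ hp => (Z.mem_localTriv_source ..).2 (proj_mem hp))) hp hq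
  choose! base base_mem using fun i (h : (U i).Nonempty) => h
  refine ⟨fun i => coord i (base i), fun i j ⟨p, hpi, hpj⟩ => ?_⟩
  calc
    coord j (base j) = coord j p := coord_constant j (base_mem j ⟨p, hpj⟩) hpj
    _ = c j i * coord i p := hc.localTriv_snd hU hU_cover (proj_mem hpi) (proj_mem hpj)
    _ = c j i * coord i (base i) := by rw [coord_constant i (base_mem i ⟨p, hpi⟩) hpi]

end CechCocycle

section StdSimplex

variable {ι κ : Type*} [Fintype ι]

theorem stdSimplex_map_pos_iff [Fintype κ] (f : ι → κ) (t : stdSimplex ℝ ι) (k : κ) :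
    0 < stdSimplex.map f t k ↔ ∃ i, f i = k ∧ 0 < t i := by
  classical
  rw [stdSimplex.map_coe, FunOnFinite.linearMap_apply_apply,
    Finset.sum_pos_iff_of_nonneg fun i _ => stdSimplex.zero_le t i]
  simp

theorem exists_pos_stdSimplex (t : stdSimplex ℝ ι) : ∃ i, 0 < t i := by
  obtain ⟨i, -, hi⟩ := (Finset.sum_pos_iff_of_nonneg fun i _ => stdSimplex.zero_le t i).1
    ((stdSimplex.sum_eq_one t).symm ▸ one_pos)
  exact ⟨i, hi⟩

theorem isOpen_stdSimplex_pos (i : ι) : IsOpen ({t | 0 < t i} : Set (stdSimplex ℝ ι)) :=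
  isOpen_lt continuous_const ((continuous_apply i).comp continuous_subtype_val)

theorem isPreconnected_stdSimplex_pos (i : ι) :
    _root_.IsPreconnected ({t | 0 < t i} : Set (stdSimplex ℝ ι)) := by
  rw [← Topology.IsInducing.subtypeVal.isPreconnected_image]
  have h_image : Subtype.val '' ({t | 0 < t i} : Set (stdSimplex ℝ ι)) =
      stdSimplex ℝ ι ∩ {t | 0 < t i} :=
    Subtype.image_preimage_coe (stdSimplex ℝ ι) {t | 0 < t i}
  rw [h_image]
  exact ((convex_stdSimplex ℝ ι).inter
    (convex_halfSpace_gt (LinearMap.proj i).isLinear 0)).isPreconnected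

end StdSimplex

section OpenStar

variable {X : SSet.{u}}

/-- The `i`-th vertex of a simplex. -/
def vertex {n : SimplexCategory} (x : X.obj (op n)) (i : Fin (n.len + 1)) : X _⦋0⦌ :=
  X.map (SimplexCategory.const ⦋0⦌ n i).op x

@[simp]
theorem vertex_map {m n : SimplexCategory} (f : m ⟶ n) (x : X.obj (op n)) (i : Fin (m.len + 1)) :
    vertex (X.map f.op x) i = vertex x (f i) := by
  rw [vertex, ← Functor.map_comp_apply, ← op_comp, SimplexCategory.const_comp]
  rfl

theorem characteristicMap_vertex {n : SimplexCategory} (x : X.obj (op n)) (i : Fin (n.len + 1)) :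
    characteristicMap x (stdSimplex.vertex i) =
      characteristicMap (vertex x i) (stdSimplex.vertex 0) := by
  rw [vertex, characteristicMap_map, stdSimplex.map_vertex]
  rfl

/-- The open star of a vertex `v` in the realization: the points that have a positive barycentric
coordinate at `v` in some simplex. -/
def openStar (v : X _⦋0⦌) : Set |X| :=
  {p | ∃ (n : SimplexCategory) (x : X.obj (op n)) (t : stdSimplex ℝ (Fin (n.len + 1)))
    (i : Fin (n.len + 1)), characteristicMap x t = p ∧ vertex x i = v ∧ 0 < t i}

theorem isOpen_vertex_pos {n : SimplexCategory} (x : X.obj (op n)) (v : X _⦋0⦌) :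
    IsOpen ({t | ∃ i, vertex x i = v ∧ 0 < t i} : Set (stdSimplex ℝ (Fin (n.len + 1)))) := by
  simp only [Set.ofPred_exists, Set.ofPred_and]
  exact isOpen_iUnion fun i => isOpen_const.inter (isOpen_stdSimplex_pos i)

theorem characteristicMap_mem_openStar {n : SimplexCategory} {x : X.obj (op n)}
    {t : stdSimplex ℝ (Fin (n.len + 1))} {v : X _⦋0⦌} :
    characteristicMap x t ∈ openStar v ↔ ∃ i, vertex x i = v ∧ 0 < t i := by
  obtain ⟨V, -, hV⟩ := exists_isOpen_preimage_characteristicMap_eq _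
    (fun n (x : X.obj (op n)) => isOpen_vertex_pos x v) fun m n f x => by
      ext t
      simp only [vertex_map, Set.mem_ofPred_eq, Set.mem_preimage, stdSimplex_map_pos_iff]
      aesop
  refine ⟨fun ⟨m, y, s, j, h, hj⟩ => ?_, fun ⟨i, hi⟩ => ⟨n, x, t, i, rfl, hi⟩⟩
  have h_mem : characteristicMap y s ∈ V := (Set.ext_iff.1 (hV m y) s).2 ⟨j, hj⟩
  rw [h] at h_mem
  exact (Set.ext_iff.1 (hV n x) t).1 h_mem

theorem isOpen_openStar (v : X _⦋0⦌) : IsOpen (openStar v) := by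
  refine isOpen_iff_isOpen_preimage_characteristicMap.2 fun n x => ?_
  convert isOpen_vertex_pos x v
  exact Set.ext fun t => characteristicMap_mem_openStar

theorem exists_mem_openStar (p : |X|) : ∃ v, p ∈ openStar v := by
  obtain ⟨n, x, t, rfl⟩ := exists_characteristicMap_eq p
  obtain ⟨i, hi⟩ := exists_pos_stdSimplex t
  exact ⟨vertex x i, characteristicMap_mem_openStar.2 ⟨i, rfl, hi⟩⟩

theorem isPreconnected_openStar (v : X _⦋0⦌) : _root_.IsPreconnected (openStar v) := by
  refine isPreconnected_of_forall (characteristicMap v (stdSimplex.vertex 0)) fun p hp => ?_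
  obtain ⟨n, x, t, i, rfl, rfl, hi⟩ := hp
  refine ⟨characteristicMap x '' {t | 0 < t i}, ?_, ?_, ⟨t, hi, rfl⟩, ?_⟩
  · rintro _ ⟨s, hs, rfl⟩
    exact ⟨n, x, s, i, rfl, rfl, hs⟩
  · exact ⟨stdSimplex.vertex i, by simp, characteristicMap_vertex x i⟩
  · exact (isPreconnected_stdSimplex_pos i).image _ (characteristicMap x).continuous.continuousOn

theorem openStar_inter_nonempty {n : SimplexCategory} (x : X.obj (op n)) (i j : Fin (n.len + 1)) :
    (openStar (vertex x i) ∩ openStar (vertex x j)).Nonempty := by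
  have barycenter_pos (k : Fin (n.len + 1)) :
      0 < (stdSimplex.barycenter : stdSimplex ℝ (Fin (n.len + 1))) k :=
    inv_pos.2 (Nat.cast_pos.2 Fintype.card_pos)
  exact ⟨characteristicMap x stdSimplex.barycenter,
    characteristicMap_mem_openStar.2 ⟨i, rfl, barycenter_pos i⟩,
    characteristicMap_mem_openStar.2 ⟨j, rfl, barycenter_pos j⟩⟩

variable {H : Type*} [Group H]

theorem isCechCocycle_openStar {c : X _⦋0⦌ → X _⦋0⦌ → H}
    (hc : ∀ (n : SimplexCategory) (x : X.obj (op n)) (i j k : Fin (n.len + 1)),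
      c (vertex x i) (vertex x j) * c (vertex x j) (vertex x k) = c (vertex x i) (vertex x k)) :
    IsCechCocycle openStar c := by
  rintro _ _ _ ⟨p, ⟨hu, hv⟩, hw⟩
  obtain ⟨n, x, t, rfl⟩ := exists_characteristicMap_eq p
  obtain ⟨i, rfl, -⟩ := characteristicMap_mem_openStar.1 hu
  obtain ⟨j, rfl, -⟩ := characteristicMap_mem_openStar.1 hv
  obtain ⟨k, rfl, -⟩ := characteristicMap_mem_openStar.1 hw
  exact hc n x i j k

theorem exists_coboundary_of_simplyConnectedSpace [SimplyConnectedSpace |X|]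
    {c : X _⦋0⦌ → X _⦋0⦌ → H}
    (hc : ∀ (n : SimplexCategory) (x : X.obj (op n)) (i j k : Fin (n.len + 1)),
      c (vertex x i) (vertex x j) * c (vertex x j) (vertex x k) = c (vertex x i) (vertex x k)) :
    ∃ u : X _⦋0⦌ → H, ∀ (n : SimplexCategory) (x : X.obj (op n)) (i j : Fin (n.len + 1)),
      u (vertex x j) = c (vertex x j) (vertex x i) * u (vertex x i) := by
  obtain ⟨u, hu⟩ := (isCechCocycle_openStar hc).exists_coboundary isOpen_openStar
    exists_mem_openStar isPreconnected_openStar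
  exact ⟨u, fun n x i j => hu _ _ (openStar_inter_nonempty x i j)⟩

end OpenStar

section ExtraDegeneracy

/-- The point `(1 - s, s t₀, …, s tₙ)` of the simplex `Δⁿ⁺¹`, seen as the cone over `Δⁿ` with
apex the vertex `0`. -/
def conePoint {n : ℕ} (s : unitInterval) (t : stdSimplex ℝ (Fin (n + 1))) :
    stdSimplex ℝ (Fin (n + 2)) :=
  ⟨Fin.cons (1 - (s : ℝ)) fun i => s * t i,
    Fin.cases (sub_nonneg.2 s.2.2) fun i => mul_nonneg s.2.1 (stdSimplex.zero_le t i), by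
      rw [Fin.sum_univ_succ]
      simp [← Finset.mul_sum]⟩

@[simp]
theorem conePoint_apply_zero {n : ℕ} (s : unitInterval) (t : stdSimplex ℝ (Fin (n + 1))) :
    conePoint s t 0 = 1 - s := rfl

@[simp]
theorem conePoint_apply_succ {n : ℕ} (s : unitInterval) (t : stdSimplex ℝ (Fin (n + 1)))
    (i : Fin (n + 1)) : conePoint s t i.succ = s * t i := rfl

theorem continuous_conePoint {n : ℕ} :
    Continuous fun q : stdSimplex ℝ (Fin (n + 1)) × unitInterval => conePoint q.2 q.1 := by
  refine Continuous.subtype_mk (continuous_pi (Fin.cases ?_ fun i => ?_)) _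
  · simp only [Fin.cons_zero]
    fun_prop
  · simp only [Fin.cons_succ]
    exact (continuous_subtype_val.comp continuous_snd).mul
      ((continuous_apply i).comp (continuous_subtype_val.comp continuous_fst))

theorem conePoint_zero {n : ℕ} (t : stdSimplex ℝ (Fin (n + 1))) :
    conePoint 0 t = stdSimplex.vertex 0 := by
  ext i
  cases i using Fin.cases <;> simp

theorem conePoint_one {n : ℕ} (t : stdSimplex ℝ (Fin (n + 1))) :
    conePoint 1 t = stdSimplex.map Fin.succ t := by
  ext i
  cases i using Fin.cases <;> simp [FunOnFinite.linearMap_apply_apply, Finset.sum_filter]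

theorem map_cons_conePoint {m n : ℕ} (f : Fin (m + 1) → Fin (n + 1)) (s : unitInterval)
    (t : stdSimplex ℝ (Fin (m + 1))) :
    stdSimplex.map (Fin.cons 0 fun i => (f i).succ : Fin (m + 2) → Fin (n + 2)) (conePoint s t) =
      conePoint s (stdSimplex.map f t) := by
  ext i
  rw [stdSimplex.map_coe, FunOnFinite.linearMap_apply_apply, Finset.sum_filter,
    Fin.sum_univ_succ]
  cases i using Fin.cases with
  | zero => simp
  | succ i =>
    simp [(Fin.succ_ne_zero i).symm, FunOnFinite.linearMap_apply_apply, Finset.sum_filter,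
      Finset.mul_sum]

/-- The functor `[n] ↦ [n + 1]` that adjoins a new initial vertex `0`. -/
def coneFunctor : SimplexCategory ⥤ SimplexCategory where
  obj n := ⦋n.len + 1⦌
  map f := SimplexCategory.mkHom ⟨Fin.cons 0 fun i => (f i).succ, by
    refine Fin.cases (fun j _ => Fin.zero_le _) fun i => Fin.cases (fun h => ?_) fun j h => ?_
    · exact absurd h (by simp)
    · exact Fin.succ_le_succ_iff.2 (f.toOrderHom.monotone (Fin.succ_le_succ_iff.1 h))⟩
  map_id n := by
    ext i
    cases i using Fin.cases <;> rfl
  map_comp f g := by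
    ext i
    cases i using Fin.cases <;> rfl

theorem coneFunctor_map_δ {n : ℕ} (i : Fin (n + 2)) :
    coneFunctor.map (SimplexCategory.δ i) = SimplexCategory.δ i.succ := by
  ext j
  cases j using Fin.cases with
  | zero => exact congrArg Fin.val (Fin.succ_succAbove_zero i).symm
  | succ j => exact congrArg Fin.val (Fin.succ_succAbove_succ i j).symm

theorem coneFunctor_map_σ {n : ℕ} (i : Fin (n + 1)) :
    coneFunctor.map (SimplexCategory.σ i) = SimplexCategory.σ i.succ := by
  ext j
  cases j using Fin.cases with
  | zero => rfl
  | succ j => exact congrArg Fin.val (Fin.succ_predAbove_succ i j).symm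

variable {X : SSet.Augmented.{u}} (ed : SimplicialObject.Augmented.ExtraDegeneracy X)

/-- The operators of an extra degeneracy, assembled into a natural transformation. -/
def extraDegeneracyNatTrans : X.left ⟶ coneFunctor.op ⋙ X.left where
  app n := ed.s n.unop.len
  naturality := by
    let s (n : SimplexCategoryᵒᵖ) : X.left.obj n ⟶ (coneFunctor.op ⋙ X.left).obj n :=
      ed.s n.unop.len
    have h_top : (MorphismProperty.naturalityProperty s).unop = ⊤ := by
      refine SimplexCategory.morphismProperty_eq_top _ (fun {n} i => ?_) fun {n} i => ?_
      · change _ = ed.s (n + 1) ≫ X.left.map (coneFunctor.map (SimplexCategory.δ i)).op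
        rw [coneFunctor_map_δ]
        exact (ed.s_comp_δ n i).symm
      · change _ = ed.s n ≫ X.left.map (coneFunctor.map (SimplexCategory.σ i)).op
        rw [coneFunctor_map_σ]
        exact (ed.s_comp_σ n i).symm
    exact fun m n f => h_top.ge f.unop trivial

/-- The cone over a simplex that is given by an extra degeneracy; its apex is the vertex `0`. -/
def coneSimplex {n : SimplexCategory} (x : X.left.obj (op n)) :
    X.left.obj (op (coneFunctor.obj n)) :=
  (extraDegeneracyNatTrans ed).app (op n) x

theorem coneSimplex_map {m n : SimplexCategory} (f : m ⟶ n) (x : X.left.obj (op n)) :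
    coneSimplex ed (X.left.map f.op x) = X.left.map (coneFunctor.map f).op (coneSimplex ed x) :=
  NatTrans.naturality_apply (extraDegeneracyNatTrans ed) f.op x

theorem map_δ_zero_coneSimplex {n : SimplexCategory} (x : X.left.obj (op n)) :
    X.left.map (SimplexCategory.δ 0 : n ⟶ coneFunctor.obj n).op (coneSimplex ed x) = x :=
  ConcreteCategory.congr_hom (ed.s_comp_δ₀ n.len) x

theorem vertex_coneSimplex_zero {n : SimplexCategory} (x : X.left.obj (op n)) :
    vertex (coneSimplex ed x) 0 = ed.s' (X.hom.app (op n) x) := by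
  have h_δ : SimplexCategory.const ⦋0⦌ ⦋1⦌ 0 = SimplexCategory.δ 1 := by
    ext i
    fin_cases i
    rfl
  calc
    vertex (coneSimplex ed x) 0 = vertex (coneSimplex ed (vertex x 0)) 0 := by
      rw [vertex.eq_def x, coneSimplex_map]
      exact (vertex_map (coneFunctor.map (SimplexCategory.const ⦋0⦌ n 0)) _ 0).symm
    _ = X.left.map (SimplexCategory.δ 1 : ⦋0⦌ ⟶ ⦋1⦌).op (coneSimplex ed (vertex x 0)) := by
      rw [← h_δ]
      rfl
    _ = ed.s' (X.hom.app (op ⦋0⦌) (vertex x 0)) :=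
      ConcreteCategory.congr_hom ed.s₀_comp_δ₁ (vertex x 0)
    _ = ed.s' (X.hom.app (op n) x) :=
      congrArg ed.s' (NatTrans.naturality_apply X.hom (SimplexCategory.const ⦋0⦌ n 0).op x)

/-- The homotopy that moves the points of `|X|` linearly away from the apex of the cone. -/
def coneHomotopy : C(|X.left|, C(unitInterval, |X.left|)) :=
  realizationDesc
    (fun n x => ContinuousMap.curry
      ((characteristicMap (coneSimplex ed x)).comp ⟨_, continuous_conePoint⟩))
    (fun m n f x t => by
      ext s
      change characteristicMap (coneSimplex ed (X.left.map f.op x)) (conePoint s t) =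
        characteristicMap (coneSimplex ed x) (conePoint s (stdSimplex.map f t))
      rw [coneSimplex_map, ← map_cons_conePoint]
      exact characteristicMap_map _ _ _)

theorem coneHomotopy_characteristicMap {n : SimplexCategory} (x : X.left.obj (op n))
    (t : stdSimplex ℝ (Fin (n.len + 1))) (s : unitInterval) :
    coneHomotopy ed (characteristicMap x t) s =
      characteristicMap (coneSimplex ed x) (conePoint s t) :=
  DFunLike.congr_fun (realizationDesc_characteristicMap _ _ x t) s

theorem contractibleSpace_of_extraDegeneracy [Unique X.right]
    (ed : SimplicialObject.Augmented.ExtraDegeneracy X) : ContractibleSpace |X.left| := by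
  rw [contractible_iff_id_nullhomotopic]
  refine ⟨characteristicMap (ed.s' default) (stdSimplex.vertex 0),
    ContinuousMap.Homotopic.symm ⟨⟨(coneHomotopy ed).uncurry.comp .prodSwap, ?_, ?_⟩⟩⟩
  · intro p
    obtain ⟨n, x, t, rfl⟩ := exists_characteristicMap_eq p
    change coneHomotopy ed (characteristicMap x t) 0 = _
    rw [coneHomotopy_characteristicMap, conePoint_zero]
    refine (characteristicMap_vertex _ 0).trans ?_
    rw [vertex_coneSimplex_zero]
    exact congrArg (fun y => characteristicMap (ed.s' y) _) (Unique.eq_default (α := X.right) _)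
  · intro p
    obtain ⟨n, x, t, rfl⟩ := exists_characteristicMap_eq p
    change coneHomotopy ed (characteristicMap x t) 1 = characteristicMap x t
    rw [coneHomotopy_characteristicMap, conePoint_one]
    refine (characteristicMap_map (SimplexCategory.δ 0 : n ⟶ coneFunctor.obj n) _ t).symm.trans ?_
    rw [map_δ_zero_coneSimplex]

end ExtraDegeneracy

section UniversalBundle

variable {V : Type u}

/-- The simplicial set `E V` with its augmentation to a point. -/
def augmentedE (V : Type u) : SSet.Augmented.{u} :=
  SimplicialObject.augmentOfIsTerminal (E V) (T := PUnit.{u + 1}) Limits.Types.isTerminalPUnit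

/-- The extra degeneracy `(x₀, …, xₙ) ↦ (v, x₀, …, xₙ)` of `E V`. -/
def extraDegeneracyE (v : V) : SimplicialObject.Augmented.ExtraDegeneracy (augmentedE V) where
  s' := ↾fun _ _ => v
  s n := ↾fun x => (Fin.cons v x : Fin (n + 2) → V)
  s'_comp_ε := rfl
  s₀_comp_δ₁ := by
    ext x
    funext j
    fin_cases j
    rfl
  s_comp_δ₀ _ := rfl
  s_comp_δ n i := by
    ext x
    funext j
    cases j using Fin.cases with
    | zero => rfl
    | succ j =>
      exact congrArg (Fin.cons v x : Fin (n + 3) → V) (Fin.succ_succAbove_succ i j)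
  s_comp_σ n i := by
    ext x
    funext j
    cases j using Fin.cases with
    | zero => rfl
    | succ j =>
      exact congrArg (Fin.cons v x : Fin (n + 2) → V) (Fin.succ_predAbove_succ i j)

instance [Nonempty V] : ContractibleSpace |E V| :=
  have : Unique (augmentedE V).right := inferInstanceAs (Unique PUnit)
  contractibleSpace_of_extraDegeneracy (extraDegeneracyE (Classical.arbitrary V))

end UniversalBundle

section Commutators

variable {G : Type u} [Group G]

theorem nilpotentOfClassLT_two_iff {K : Subgroup G} :
    NilpotentOfClassLT 2 K ↔ IsMulCommutative K := by
  refine ⟨fun ⟨_, hK⟩ => Group.IsNilpotent.nilpotencyClass_le_one_iff.1 (Nat.lt_succ_iff.1 hK),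
    fun hK => ?_⟩
  have _ : Group.IsNilpotent K := ⟨1, Subgroup.upperCentralSeries_one_eq_top_iff.2 hK⟩
  exact ⟨‹_›, Nat.lt_succ_iff.2 (Group.IsNilpotent.nilpotencyClass_le_one_iff.2 hK)⟩

theorem Enil_eq_top {q : ℕ} (hG : NilpotentOfClassLT q (⊤ : Subgroup G)) : Enil q G = ⊤ := by
  ext n x
  exact iff_of_true (hG.mono le_top) trivial

theorem contractibleSpace_Enil {q : ℕ} (hG : NilpotentOfClassLT q (⊤ : Subgroup G)) :
    ContractibleSpace |(Enil q G).toSSet| := by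
  rw [Enil_eq_top hG]
  exact (TopCat.homeoOfIso (SSet.toTop.mapIso (SSet.Subcomplex.topIso (E G)))).contractibleSpace

theorem inv_mul_mem_closure {n : ℕ} (x : Fin (n + 1) → G) (i j : Fin (n + 1)) :
    (x i)⁻¹ * x j ∈
      Subgroup.closure (Set.range fun k : Fin n => (x k.castSucc)⁻¹ * x k.succ) := by
  have h_mem := mul_mem
    (inv_mem (partialProd_mem_closure (fun k : Fin n => (x k.castSucc)⁻¹ * x k.succ) i))
    (partialProd_mem_closure _ j)
  rwa [partialProd_inv_mul x, partialProd_inv_mul x, mul_inv_rev, inv_inv, mul_assoc,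
    mul_inv_cancel_left] at h_mem

theorem commute_of_mem_Enil_two {n : SimplexCategory} {x : Fin (n.len + 1) → G}
    (hx : x ∈ (Enil 2 G).obj (op n)) (i j k l : Fin (n.len + 1)) :
    Commute ((x i)⁻¹ * x j) ((x k)⁻¹ * x l) := by
  have _ : IsMulCommutative
      (Subgroup.closure (Set.range fun k : Fin n.len => (x k.castSucc)⁻¹ * x k.succ)) :=
    nilpotentOfClassLT_two_iff.1 hx
  exact setLike_mul_comm (inv_mul_mem_closure x i j) (inv_mul_mem_closure x k l)

theorem commutator_mul_commutator {a b c : G} (h : Commute (a⁻¹ * b) (b⁻¹ * c)) :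
    ⁅a, b⁆ * ⁅b, c⁆ = ⁅a, c⁆ := by
  have h_conj : Commute (b * a⁻¹) (c * b⁻¹) := by
    simpa [mul_assoc] using (Commute.conj_iff b).2 h
  calc
    ⁅a, b⁆ * ⁅b, c⁆ = a * ((b * a⁻¹) * (c * b⁻¹)) * c⁻¹ := by
      simp only [commutatorElement_def]
      group
    _ = a * ((c * b⁻¹) * (b * a⁻¹)) * c⁻¹ := by rw [h_conj.eq]
    _ = ⁅a, c⁆ := by
      rw [commutatorElement_def]
      group

theorem mem_Enil_two_of_len_le_one {n : SimplexCategory} (hn : n.len ≤ 1)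
    (x : Fin (n.len + 1) → G) : x ∈ (Enil 2 G).obj (op n) := by
  have _ : Subsingleton (Fin n.len) := Fin.subsingleton_iff_le_one.2 hn
  refine nilpotentOfClassLT_two_iff.2 (Subgroup.isMulCommutative_closure ?_)
  rintro _ ⟨i, rfl⟩ _ ⟨j, rfl⟩
  rw [Subsingleton.elim i j]

theorem mul_comm_of_simplyConnectedSpace_Enil_two [SimplyConnectedSpace |(Enil 2 G).toSSet|]
    (a b : G) : a * b = b * a := by
  obtain ⟨u, hu⟩ := exists_coboundary_of_simplyConnectedSpace (X := (Enil 2 G).toSSet)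
    (c := fun v w => ⁅v.1 0, w.1 0⁆)
    fun n x i j k => commutator_mul_commutator (commute_of_mem_Enil_two x.2 i j j k)
  let potential (g : G) : G :=
    u ⟨fun _ => g, mem_Enil_two_of_len_le_one (n := ⦋0⦌) zero_le_one _⟩
  have potential_eq (a b : G) : potential b = ⁅b, a⁆ * potential a :=
    hu ⦋1⦌ ⟨(![a, b] : Fin 2 → G), mem_Enil_two_of_len_le_one (n := ⦋1⦌) le_rfl _⟩ 0 1
  have potential_eq_potential_one (g : G) : potential g = potential 1 := by
    rw [potential_eq 1 g, commutatorElement_one_right, one_mul]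
  have commutator_mul_potential : ⁅a, b⁆ * potential b = potential b := by
    rw [← potential_eq, potential_eq_potential_one a, potential_eq_potential_one b]
  exact commutatorElement_eq_one_iff_mul_comm.1 (mul_eq_right.1 commutator_mul_potential)

end Commutators

end ClassifyingSpace

end

theorem mainTheorem5_general (G : Type u) [Group G] :
    List.TFAE [∀ a b : G, a * b = b * a,
      SimplyConnectedSpace |(ClassifyingSpace.Enil 2 G).toSSet|,
      ContractibleSpace |(ClassifyingSpace.Enil 2 G).toSSet|] := by
  tfae_have 1 → 3 := fun h => ClassifyingSpace.contractibleSpace_Enil <|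
    ClassifyingSpace.nilpotentOfClassLT_two_iff.2 ⟨⟨fun a b => Subtype.ext (h a b)⟩⟩
  tfae_have 3 → 2 := fun _ => inferInstance
  tfae_have 2 → 1 := fun _ => ClassifyingSpace.mul_comm_of_simplyConnectedSpace_Enil_two
  tfae_finish

theorem mainTheorem5 (G : Type u) [Group G] :
    (∀ a b : G, a * b = b * a) ↔
      ContractibleSpace (SSet.toTop.obj (ClassifyingSpace.Enil 2 G).toSSet) :=
  (mainTheorem5_general G).out 0 2
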